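/- For $x\in\mathbb{C}$ let $B(x,t)=\sum_{n\ge 0}B_n(x)\,t^n\in\mathbb{C}[[t]]$ be the ordinary generating function of the Bernoulli polynomials $B_n(x)$, which are defined by $\frac{t}{e^t-1}\,e^{xt}=\sum_{n\ge 0}B_n(x)\frac{t^n}{n!}$. Then, for every $x\in\mathbb{C}$, the power series $B(x,t)$ is differentially transcendental over $\mathbb{C}(t)$: for every integer $n\ge 0$ and every nonzero polynomial $P\in\mathbb{C}(t)[X_0,X_1,\dots,X_n]$ one has $$P\bigl(B(x,t),\,\partial_t B(x,t),\,\dots,\,\partial_t^{\,n}B(x,t)\bigr)\neq 0 \quad\text{in } \mathbb{C}((t)).$$ -/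

import Mathlib

open scoped LaurentSeries RatFunc

/-- A formal Laurent series `f ∈ ℂ((t))` is differentially transcendental over `ℂ(t)` if
`P(f, f', …, f⁽ⁿ⁾) ≠ 0` for every `n ≥ 0` and every nonzero polynomial
`P ∈ ℂ(t)[X₀, X₁, …, Xₙ]`. Here `'` is the formal derivative with respect to `t`, and `ℂ(t)` acts
on `ℂ((t))` by expansion at `t = 0`. -/
def IsDiffTranscendental (f : ℂ⸨X⸩) : Prop :=
  ∀ (n : ℕ) (P : MvPolynomial (Fin (n + 1)) (RatFunc ℂ)), P ≠ 0 →
    MvPolynomial.aeval (fun i : Fin (n + 1) => (LaurentSeries.derivative ℂ)^[(i : ℕ)] f) P ≠ 0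

/-- The ordinary generating function `B(x, t) = ∑ₙ Bₙ(x) tⁿ ∈ ℂ[[t]]` of the values at `x ∈ ℂ` of
the Bernoulli polynomials. -/
noncomputable def bernoulliOGF (x : ℂ) : PowerSeries ℂ :=
  PowerSeries.mk fun n => Polynomial.aeval x (Polynomial.bernoulli n)

/-! Put `s = 1/t` and `F = t B(x,t)`. The substitution `t ↦ t/(1-t)`, i.e. `s ↦ s - 1`, sends `F` to
`F + (s-x)⁻²`; this is the Bernoulli recurrence (`seriesShift_X_mul_bernoulliOGF`). It commutes with
`d/ds = -t² d/dt`, so each `(d/ds)ⁱ F` is shifted by a nonzero constant times `(s-x)^(-(i+2))`.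

If these derivatives were algebraically dependent over `ℂ(t)`, a minimal relation would force a
nontrivial linear combination of the increments, with shift-invariant coefficients, to equal `h(s) -
h(s-1)` with `h` rational (`exists_telescoper_of_aeval_eq_zero`). Invariant rational functions are
constants, so the combination has a pole at `s = x` and nowhere else. But `h(s) - h(s-1)` never has
exactly one pole (`regularAt_of_eq_sub_ratShift`).

Finally, the `(d/ds)ⁱ F` and the `∂ₜʲ B` differ by an invertible triangular matrix over `ℂ(t)`. -/

namespace MvPolynomial

/-! ### Total degree and partial derivatives. -/

section TotalDegree

variable {ι R : Type*} [CommSemiring R]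

theorem degree_le_of_coeff_ne_zero {p : MvPolynomial ι R} {m : ι →₀ ℕ} (h : coeff m p ≠ 0) :
    m.degree ≤ p.totalDegree :=
  le_totalDegree (mem_support_iff.2 h)

theorem totalDegree_le_of_degree_le {p : MvPolynomial ι R} {n : ℕ}
    (h : ∀ m, coeff m p ≠ 0 → m.degree ≤ n) : p.totalDegree ≤ n :=
  Finset.sup_le fun m hm => h m (mem_support_iff.1 hm)

theorem totalDegree_pderiv_le {p : MvPolynomial ι R} {n : ℕ} (h : p.totalDegree ≤ n + 1) (i : ι) :
    (pderiv i p).totalDegree ≤ n := by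
  refine totalDegree_le_of_degree_le fun m hm => ?_
  rw [coeff_pderiv] at hm
  have := (degree_le_of_coeff_ne_zero (left_ne_zero_of_mul hm)).trans h
  rw [map_add, Finsupp.degree_single] at this
  omega

theorem eq_C_of_pderiv_eq_zero {ι K : Type*} [Field K] [CharZero K] {p : MvPolynomial ι K}
    (h : ∀ i, pderiv i p = 0) : p = C (coeff 0 p) := by
  classical
  ext m
  rw [coeff_C]
  split_ifs with hm
  · rw [hm]
  · obtain ⟨i, hi⟩ := Finsupp.ne_iff.1 (Ne.symm hm)
    have hle : Finsupp.single i 1 ≤ m := by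
      rw [Finsupp.single_le_iff]
      exact Nat.one_le_iff_ne_zero.2 hi
    have := congrArg (coeff (m - Finsupp.single i 1)) (h i)
    rw [coeff_pderiv, tsub_add_cancel_of_le hle, coeff_zero] at this
    exact (mul_eq_zero.1 this).resolve_right (Nat.cast_add_one_ne_zero _)

end TotalDegree

/-! ### From algebraic dependence to a telescoping linear relation. -/

section ShiftHom

variable {ι K : Type*} [Field K] (σ : K →+* K) (g : ι → K)

/-- The semilinear ring endomorphism of `K[Xᵢ]` which acts by `σ` on the coefficients and
sends `Xᵢ` to `Xᵢ + gᵢ`. -/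
noncomputable def shiftHom : MvPolynomial ι K →+* MvPolynomial ι K :=
  eval₂Hom (C.comp σ) fun i => X i + C (g i)

@[simp]
theorem shiftHom_C (a : K) : shiftHom σ g (C a) = C (σ a) := by simp [shiftHom]

@[simp]
theorem shiftHom_X (i : ι) : shiftHom σ g (X i) = X i + C (g i) := by simp [shiftHom]

theorem aeval_shiftHom {L : Type*} [Field L] [Algebra K L] (τ : L →+* L)
    (hτ : ∀ a, τ (algebraMap K L a) = algebraMap K L (σ a)) {y : ι → L}
    (hy : ∀ i, τ (y i) = y i + algebraMap K L (g i)) (p : MvPolynomial ι K) :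
    aeval y (shiftHom σ g p) = τ (aeval y p) := by
  induction p using MvPolynomial.induction_on with
  | C a => simp [hτ]
  | add p q hp hq => simp [hp, hq]
  | mul_X p i hp => simp [hp, hy]

theorem pderiv_shiftHom (i : ι) (p : MvPolynomial ι K) :
    pderiv i (shiftHom σ g p) = shiftHom σ g (pderiv i p) := by
  classical
  induction p using MvPolynomial.induction_on with
  | C a => simp
  | add p q hp hq => simp [hp, hq]
  | mul_X p j hp =>
    by_cases hij : j = i
    · subst hij; simp [hp]
    · simp [hp, pderiv_X_of_ne hij]

/-- Expanding a product of factors `Xᵢ + gᵢ` gives the monomial itself plus terms of strictly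
smaller degree. -/
theorem coeff_shiftHom_monomial (s m : ι →₀ ℕ) (h : s.degree ≤ m.degree) :
    coeff m (shiftHom σ g (monomial s 1)) = coeff m (monomial s 1) := by
  classical
  induction hn : s.degree generalizing s m with
  | zero =>
    obtain rfl := (Finsupp.degree_eq_zero_iff s).1 hn
    rw [← C_apply, shiftHom_C, map_one]
  | succ n ih =>
    obtain ⟨i, hi⟩ : ∃ i, s i ≠ 0 := by
      by_contra! hs
      have : s = 0 := Finsupp.ext hs
      simp [this] at hn
    obtain ⟨s, rfl⟩ : ∃ s', s = s' + Finsupp.single i 1 :=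
      ⟨s - Finsupp.single i 1, (tsub_add_cancel_of_le (by
        rw [Finsupp.single_le_iff]; exact Nat.one_le_iff_ne_zero.2 hi)).symm⟩
    rw [map_add, Finsupp.degree_single] at hn h
    have hmul : monomial (s + Finsupp.single i 1) (1 : K) = monomial s 1 * X i := by
      simp [X, monomial_mul]
    have hsm : coeff m (monomial s (1 : K)) = 0 := by
      rw [coeff_monomial, if_neg]
      rintro rfl
      omega
    rw [hmul, map_mul, shiftHom_X, mul_add, coeff_add, mul_comm _ (C (g i)), coeff_C_mul,
      ih s m (by omega) (by omega), coeff_mul_X', coeff_mul_X', hsm, mul_zero, add_zero]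
    split_ifs with hm
    · have hle : Finsupp.single i 1 ≤ m := by
        rw [Finsupp.single_le_iff]
        exact Nat.one_le_iff_ne_zero.2 (Finsupp.mem_support_iff.1 hm)
      have := congrArg Finsupp.degree (tsub_add_cancel_of_le hle)
      rw [map_add, Finsupp.degree_single] at this
      exact ih s _ (by omega) (by omega)
    · rfl

theorem coeff_shiftHom (p : MvPolynomial ι K) (m : ι →₀ ℕ) (h : p.totalDegree ≤ m.degree) :
    coeff m (shiftHom σ g p) = σ (coeff m p) := by
  classical
  conv_lhs => rw [p.as_sum, map_sum, coeff_sum]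
  conv_rhs => rw [p.as_sum, coeff_sum, map_sum]
  refine Finset.sum_congr rfl fun s hs => ?_
  rw [show monomial s (coeff s p) = C (coeff s p) * monomial s 1 by simp [C_mul_monomial],
    map_mul, shiftHom_C, coeff_C_mul, coeff_C_mul,
    coeff_shiftHom_monomial _ _ _ _ ((le_totalDegree hs).trans h), map_mul, coeff_monomial]
  split_ifs <;> simp

theorem totalDegree_shiftHom_le (p : MvPolynomial ι K) :
    (shiftHom σ g p).totalDegree ≤ p.totalDegree := by
  refine totalDegree_le_of_degree_le fun m hm => ?_
  by_contra! hlt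
  rw [coeff_shiftHom _ _ _ _ hlt.le] at hm
  refine hm ?_
  by_contra hne
  exact absurd (degree_le_of_coeff_ne_zero fun h => hne (by rw [h, map_zero])) (by omega)

/-- Partial derivatives of an invariant polynomial are invariant, so one may differentiate until all
partials are constants. The polynomial is then `h + ∑ cᵢ Xᵢ`, and comparing it with its shift gives
the relation. -/
theorem exists_telescoper_of_shiftHom_eq [Fintype ι] [CharZero K] {n : ℕ} (p : MvPolynomial ι K)
    (hle : p.totalDegree ≤ n) (hp : p.totalDegree ≠ 0) (hT : shiftHom σ g p = p) :
    ∃ (c : ι → K) (h : K), c ≠ 0 ∧ (∀ i, σ (c i) = c i) ∧ ∑ i, c i * g i = h - σ h := by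
  classical
  induction n generalizing p with
  | zero => exact absurd (Nat.le_zero.1 hle) hp
  | succ n ih =>
    have hTd : ∀ i, shiftHom σ g (pderiv i p) = pderiv i p := fun i => by
      rw [← pderiv_shiftHom, hT]
    by_cases hd : ∃ i, (pderiv i p).totalDegree ≠ 0
    · obtain ⟨i, hi⟩ := hd
      exact ih _ (totalDegree_pderiv_le hle i) hi (hTd i)
    · push Not at hd
      have hc : ∀ i, pderiv i p = C (coeff 0 (pderiv i p)) := fun i =>
        totalDegree_eq_zero_iff_eq_C.1 (hd i)
      generalize hcd : (fun i => coeff 0 (pderiv i p)) = c at hc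
      replace hc : ∀ i, pderiv i p = C (c i) := fun i => by rw [hc i, ← hcd]
      have hlin : p - ∑ i, C (c i) * X i = C (coeff 0 (p - ∑ i, C (c i) * X i)) := by
        refine eq_C_of_pderiv_eq_zero fun i => ?_
        simp [hc, pderiv_X, Pi.single_apply]
      generalize coeff 0 (p - ∑ i, C (c i) * X i) = h at hlin
      have hpe : p = C h + ∑ i, C (c i) * X i := by rw [← hlin]; ring
      have hσ : ∀ i, σ (c i) = c i := fun i => by
        have := hTd i
        rw [hc i, shiftHom_C] at this
        exact C_injective _ _ this
      refine ⟨c, h, fun h0 => hp ?_, hσ, ?_⟩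
      · rw [hpe, h0]; simp
      · have := hT
        rw [hpe] at this
        simp only [map_add, map_sum, map_mul, shiftHom_C, shiftHom_X, hσ, mul_add,
          Finset.sum_add_distrib] at this
        refine C_injective ι K ?_
        simp only [map_sum, map_mul, map_sub]
        linear_combination this

/-- A relation `r` that is minimal and has a leading coefficient 1 must be invariant: its shift
minus `r` is again a relation, and a smaller one. -/
theorem exists_shiftHom_eq_of_aeval_eq_zero {L : Type*} [Field L] [Algebra K L] (τ : L →+* L)
    (hτ : ∀ a, τ (algebraMap K L a) = algebraMap K L (σ a)) {y : ι → L}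
    (hy : ∀ i, τ (y i) = y i + algebraMap K L (g i))
    (hex : ∃ p : MvPolynomial ι K, p ≠ 0 ∧ aeval y p = 0) :
    ∃ p : MvPolynomial ι K, p.totalDegree ≠ 0 ∧ shiftHom σ g p = p := by
  classical
  set S : Set (MvPolynomial ι K) := {p | p ≠ 0 ∧ aeval y p = 0} with hS
  have hSne : S.Nonempty := hex
  -- Minimality is lexicographic: total degree first, then the number of monomials of top degree.
  set μ : MvPolynomial ι K → ℕ ×ₗ ℕ := fun p =>
    toLex (p.totalDegree, (p.support.filter fun m => m.degree = p.totalDegree).card) with hμ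
  obtain ⟨p, ⟨hp0, hpy⟩, hmin⟩ : ∃ p ∈ S, ∀ q ∈ S, ¬ μ q < μ p := by
    obtain ⟨p, hp, h⟩ := WellFounded.has_min (InvImage.wf μ wellFounded_lt) S hSne
    exact ⟨p, hp, h⟩
  obtain ⟨m, hm, hmd⟩ : ∃ m ∈ p.support, p.totalDegree = m.degree :=
    Finset.exists_mem_eq_sup _ (support_nonempty.2 hp0) _
  set a := coeff m p with ha
  have ha0 : a ≠ 0 := mem_support_iff.1 hm
  set r := C a⁻¹ * p with hr
  have hcoeff : ∀ s, coeff s r = a⁻¹ * coeff s p := fun s => coeff_C_mul _ _ _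
  have hsupp : r.support = p.support := by
    ext s; simp [mem_support_iff, hcoeff, ha0]
  have hdeg : r.totalDegree = p.totalDegree := by simp only [totalDegree, hsupp]
  have hry : aeval y r = 0 := by rw [hr, map_mul, hpy, mul_zero]
  have hr0 : r ≠ 0 := by rw [hr]; simp [ha0, hp0]
  refine ⟨r, fun h0 => ?_, ?_⟩
  · rw [totalDegree_eq_zero_iff_eq_C] at h0
    rw [h0, aeval_C, map_eq_zero] at hry
    rw [hry, C_0] at h0
    exact hr0 h0
  · by_contra hne
    set q := shiftHom σ g r - r with hq
    have hq0 : q ≠ 0 := sub_ne_zero.2 hne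
    have hqy : aeval y q = 0 := by
      rw [hq, map_sub, aeval_shiftHom σ g τ hτ hy, hry, map_zero, sub_zero]
    refine hmin q ⟨hq0, hqy⟩ ?_
    have hqd : q.totalDegree ≤ p.totalDegree := by
      rw [← hdeg]
      exact (totalDegree_sub _ _).trans (max_le (totalDegree_shiftHom_le σ g r) le_rfl)
    rw [hμ, Prod.Lex.toLex_lt_toLex]
    rcases hqd.lt_or_eq with hlt | heq
    · exact Or.inl hlt
    · refine Or.inr ⟨heq, Finset.card_lt_card ?_⟩
      have hcq : ∀ s : ι →₀ ℕ, s.degree = p.totalDegree → coeff s q = σ (coeff s r) - coeff s r :=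
        fun s hs => by rw [hq, coeff_sub, coeff_shiftHom _ _ _ _ (by rw [hdeg, hs])]
      -- No new top-degree monomial appears, and `m` disappears because its coefficient in `r` is 1,
      -- which `σ` fixes.
      refine (Finset.ssubset_iff_of_subset fun s hs => ?_).2 ⟨m, ?_, ?_⟩
      · rw [Finset.mem_filter, heq, mem_support_iff] at hs
        rw [Finset.mem_filter, ← hsupp, mem_support_iff]
        refine ⟨fun h => hs.1 ?_, hs.2⟩
        rw [hcq s hs.2, h, map_zero, sub_zero]
      · exact Finset.mem_filter.2 ⟨hm, hmd.symm⟩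
      · rw [Finset.mem_filter, mem_support_iff, hcq m hmd.symm, hcoeff, ← ha, inv_mul_cancel₀ ha0]
        simp

/-- If `τ` extends `σ`, `τ yᵢ = yᵢ + gᵢ` with `gᵢ ∈ K`, and the `yᵢ` are algebraically dependent
over `K`, then some nontrivial combination of the `gᵢ` with `σ`-invariant coefficients telescopes in `K`. -/
theorem exists_telescoper_of_aeval_eq_zero [Fintype ι] [CharZero K] {L : Type*} [Field L]
    [Algebra K L] (τ : L →+* L) (hτ : ∀ a, τ (algebraMap K L a) = algebraMap K L (σ a)) {y : ι → L}
    (hy : ∀ i, τ (y i) = y i + algebraMap K L (g i))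
    (hex : ∃ p : MvPolynomial ι K, p ≠ 0 ∧ aeval y p = 0) :
    ∃ (c : ι → K) (h : K), c ≠ 0 ∧ (∀ i, σ (c i) = c i) ∧ ∑ i, c i * g i = h - σ h := by
  obtain ⟨p, hp, hT⟩ := exists_shiftHom_eq_of_aeval_eq_zero σ g τ hτ hy hex
  exact exists_telescoper_of_shiftHom_eq σ g p le_rfl hp hT

end ShiftHom

end MvPolynomial

/-! ### Poles of rational functions under `s ↦ s - 1`. -/

section RationalShift

/-- The `ℂ`-algebra homomorphism `ℂ(t) → L` sending `t` to a transcendental element `z`. -/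
noncomputable def RatFunc.substHom {L : Type*} [Field L] [Algebra ℂ L] (z : L)
    (hz : Transcendental ℂ z) : RatFunc ℂ →ₐ[ℂ] L :=
  RatFunc.liftAlgHom (Polynomial.aeval z)
    (nonZeroDivisors_le_comap_nonZeroDivisors_of_injective _ (transcendental_iff_injective.1 hz))

theorem RatFunc.substHom_algebraMap {L : Type*} [Field L] [Algebra ℂ L] (z : L)
    (hz : Transcendental ℂ z) (p : Polynomial ℂ) :
    RatFunc.substHom z hz (algebraMap _ _ p) = Polynomial.aeval z p := by
  have := RatFunc.liftAlgHom_apply_div (L := L) (Polynomial.aeval z)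
    (nonZeroDivisors_le_comap_nonZeroDivisors_of_injective _ (transcendental_iff_injective.1 hz))
    p 1
  simpa [RatFunc.substHom] using this

@[simp]
theorem RatFunc.substHom_X {L : Type*} [Field L] [Algebra ℂ L] (z : L) (hz : Transcendental ℂ z) :
    RatFunc.substHom z hz RatFunc.X = z := by
  rw [← RatFunc.algebraMap_X, RatFunc.substHom_algebraMap, Polynomial.aeval_X]

theorem RatFunc.ringHom_ext_of_X {L : Type*} [Field L] {f g : RatFunc ℂ →+* L}
    (hC : ∀ a, f (RatFunc.C a) = g (RatFunc.C a)) (hX : f RatFunc.X = g RatFunc.X) : f = g := by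
  refine IsLocalization.ringHom_ext (nonZeroDivisors (Polynomial ℂ)) ?_
  refine Polynomial.ringHom_ext (fun a => ?_) ?_
  · simpa using hC a
  · simpa using hX

theorem RatFunc.transcendental_complex_X : Transcendental ℂ (RatFunc.X : RatFunc ℂ) := by
  rw [transcendental_iff]
  intro p hp
  rw [← RatFunc.algebraMap_X, Polynomial.aeval_algebraMap_apply, Polynomial.aeval_X_left_apply] at hp
  exact (map_eq_zero_iff _ (RatFunc.algebraMap_injective ℂ)).1 hp

theorem Transcendental.inv_complex {L : Type*} [Field L] [Algebra ℂ L] {z : L}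
    (hz : Transcendental ℂ z) : Transcendental ℂ z⁻¹ := fun h => hz (by simpa using h.inv)

theorem Transcendental.sub_algebraMap {L : Type*} [Field L] [Algebra ℂ L] {z : L}
    (hz : Transcendental ℂ z) (a : ℂ) : Transcendental ℂ (z - algebraMap ℂ L a) := fun h =>
  hz (by simpa using h.add (isAlgebraic_algebraMap a))

/-- The endomorphism `t ↦ t / (1 - t)` of `ℂ(t)`. In the coordinate `s = 1 / t` it is
`s ↦ s - 1`. -/
noncomputable def ratShift : RatFunc ℂ →ₐ[ℂ] RatFunc ℂ :=
  RatFunc.substHom (RatFunc.X⁻¹ - algebraMap ℂ _ 1)⁻¹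
    (RatFunc.transcendental_complex_X.inv_complex.sub_algebraMap 1).inv_complex

theorem ratShift_X : ratShift RatFunc.X = (RatFunc.X⁻¹ - 1)⁻¹ := by
  rw [ratShift, RatFunc.substHom_X, map_one]

theorem LaurentSeries.aeval_coe (f : PowerSeries ℂ) (p : Polynomial ℂ) :
    Polynomial.aeval (f : ℂ⸨X⸩) p = ((Polynomial.aeval f p : PowerSeries ℂ) : ℂ⸨X⸩) :=
  (Polynomial.hom_eval₂ p (algebraMap ℂ (PowerSeries ℂ)) (HahnSeries.ofPowerSeries ℤ ℂ) f).symm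

theorem LaurentSeries.transcendental_C_add_X (b : ℂ) :
    Transcendental ℂ ((PowerSeries.C b + PowerSeries.X : PowerSeries ℂ) : ℂ⸨X⸩) := by
  have h : Transcendental ℂ ((PowerSeries.X : PowerSeries ℂ) : ℂ⸨X⸩) := by
    rw [transcendental_iff]
    intro p hp
    have hcoe : Polynomial.aeval (PowerSeries.X : PowerSeries ℂ) p = (p : PowerSeries ℂ) := by
      have : ((Polynomial.aeval (R := ℂ) (PowerSeries.X : PowerSeries ℂ)) : Polynomial ℂ →+* _)
          = Polynomial.coeToPowerSeries.ringHom := by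
        refine Polynomial.ringHom_ext (fun a => ?_) ?_
        · simp
        · simp
      exact RingHom.congr_fun this p
    rw [LaurentSeries.aeval_coe, hcoe] at hp
    exact Polynomial.coe_injective ℂ (HahnSeries.ofPowerSeries_injective (Γ := ℤ) (by
      rw [hp, Polynomial.coe_zero, map_zero]))
  have := h.sub_algebraMap (-b)
  rwa [map_neg, sub_neg_eq_add, add_comm, HahnSeries.algebraMap_apply', ← map_add] at this

/-- Expansion of a rational function in `t` at the point `t = 1 / b`, in the local parameter
`1 / t - b`. -/
noncomputable def expandAt (b : ℂ) : RatFunc ℂ →ₐ[ℂ] ℂ⸨X⸩ :=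
  RatFunc.substHom _ (LaurentSeries.transcendental_C_add_X b).inv_complex

theorem expandAt_X (b : ℂ) : expandAt b RatFunc.X =
    (((PowerSeries.C b + PowerSeries.X : PowerSeries ℂ)) : ℂ⸨X⸩)⁻¹ := by
  rw [expandAt, RatFunc.substHom_X]

theorem expandAt_inv_X_sub (b a : ℂ) : expandAt b (RatFunc.X⁻¹ - algebraMap ℂ _ a)⁻¹ =
    ((PowerSeries.C (b - a) + PowerSeries.X : PowerSeries ℂ) : ℂ⸨X⸩)⁻¹ := by
  rw [map_inv₀, map_sub, map_inv₀, expandAt_X, inv_inv, AlgHom.commutes,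
    HahnSeries.algebraMap_apply', ← map_sub, PowerSeries.algebraMap_apply, Algebra.algebraMap_self,
    RingHom.id_apply, map_sub PowerSeries.C, add_sub_right_comm]

/-- With `s = b + u`, the shift replaces `s` by `(b - 1) + u`: same local parameter, centre moved by
one. -/
theorem expandAt_ratShift (b : ℂ) (f : RatFunc ℂ) :
    expandAt b (ratShift f) = expandAt (b - 1) f := by
  suffices h : ((expandAt b).comp ratShift : RatFunc ℂ →+* ℂ⸨X⸩) = expandAt (b - 1) from
    RingHom.congr_fun h f
  refine RatFunc.ringHom_ext_of_X (fun a => ?_) ?_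
  · simp [← RatFunc.algebraMap_eq_C]
  · have := expandAt_inv_X_sub b 1
    rw [map_one] at this
    simp [ratShift_X, this, expandAt_X]

theorem LaurentSeries.coe_inv_of_constantCoeff_ne_zero {f : PowerSeries ℂ}
    (hf : PowerSeries.constantCoeff f ≠ 0) :
    ((f⁻¹ : PowerSeries ℂ) : ℂ⸨X⸩) = (f : ℂ⸨X⸩)⁻¹ := by
  refine eq_inv_of_mul_eq_one_left ?_
  rw [← map_mul, PowerSeries.inv_mul_cancel _ hf, map_one]

/-- The point `b = 0` is `t = ∞`, where a nonconstant polynomial in `t` has a pole; hence its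
exclusion. -/
theorem expandAt_algebraMap {b : ℂ} (hb : b ≠ 0) (p : Polynomial ℂ) :
    expandAt b (algebraMap _ _ p) =
      ((Polynomial.aeval (PowerSeries.C b + PowerSeries.X)⁻¹ p : PowerSeries ℂ) : ℂ⸨X⸩) := by
  rw [expandAt, RatFunc.substHom_algebraMap, ← LaurentSeries.aeval_coe,
    LaurentSeries.coe_inv_of_constantCoeff_ne_zero (by simpa using hb)]

theorem constantCoeff_aeval_inv (b : ℂ) (p : Polynomial ℂ) :
    PowerSeries.constantCoeff
      (Polynomial.aeval (PowerSeries.C b + PowerSeries.X : PowerSeries ℂ)⁻¹ p) = p.eval b⁻¹ := by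
  rw [Polynomial.aeval_def, Polynomial.hom_eval₂, PowerSeries.constantCoeff_inv]
  have : (PowerSeries.constantCoeff.comp (algebraMap ℂ (PowerSeries ℂ))) = RingHom.id ℂ := by
    ext a; simp
  rw [this]
  simp [Polynomial.eval₂_id]

/-- The rational functions whose expansion at `t = 1 / b` has no pole. -/
def RegularAt (b : ℂ) (f : RatFunc ℂ) : Prop :=
  expandAt b f ∈ (HahnSeries.ofPowerSeries ℤ ℂ).range

theorem RegularAt.sub {b : ℂ} {f g : RatFunc ℂ} (hf : RegularAt b f) (hg : RegularAt b g) :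
    RegularAt b (f - g) := by
  rw [RegularAt, map_sub]
  exact sub_mem hf hg

theorem RegularAt.add {b : ℂ} {f g : RatFunc ℂ} (hf : RegularAt b f) (hg : RegularAt b g) :
    RegularAt b (f + g) := by
  rw [RegularAt, map_add]
  exact add_mem hf hg

theorem regularAt_ratShift {b : ℂ} {f : RatFunc ℂ} :
    RegularAt b (ratShift f) ↔ RegularAt (b - 1) f := by
  rw [RegularAt, RegularAt, expandAt_ratShift]

theorem regularAt_of_eval_denom_ne_zero {b : ℂ} {f : RatFunc ℂ} (hb : b ≠ 0)
    (h : f.denom.eval b⁻¹ ≠ 0) : RegularAt b f := by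
  rw [RegularAt, ← RatFunc.num_div_denom f, map_div₀, expandAt_algebraMap hb,
    expandAt_algebraMap hb, div_eq_mul_inv, ← LaurentSeries.coe_inv_of_constantCoeff_ne_zero
    (by rwa [constantCoeff_aeval_inv]), ← map_mul]
  exact ⟨_, rfl⟩

theorem finite_setOf_not_regularAt (f : RatFunc ℂ) : {b | ¬ RegularAt b f}.Finite := by
  have h1 : {z : ℂ | f.denom.IsRoot z}.Finite :=
    Polynomial.finite_setOfPred_isRoot f.denom_ne_zero
  refine ((h1.preimage inv_injective.injOn).union (Set.finite_singleton 0)).subset fun b hb => ?_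
  by_contra hcon
  simp only [Set.mem_union, not_or] at hcon
  exact hb (regularAt_of_eval_denom_ne_zero hcon.2 hcon.1)

theorem exists_regularAt_add_nat (f : RatFunc ℂ) (a : ℂ) : ∃ n : ℕ, RegularAt (a + n) f := by
  by_contra! h
  have hinj : Function.Injective fun n : ℕ => a + (n : ℂ) := fun m n hmn => by simpa using hmn
  exact Set.infinite_of_injective_forall_mem hinj h (finite_setOf_not_regularAt f)

theorem exists_regularAt_sub_nat (f : RatFunc ℂ) (a : ℂ) : ∃ n : ℕ, RegularAt (a - n) f := by
  by_contra! h
  have hinj : Function.Injective fun n : ℕ => a - (n : ℂ) := fun m n hmn => by simpa using hmn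
  exact Set.infinite_of_injective_forall_mem hinj h (finite_setOf_not_regularAt f)

/-- A rational function `h(s) - h(s - 1)` cannot have a pole at exactly one point `a`. -/
theorem regularAt_of_eq_sub_ratShift {r h : RatFunc ℂ} (hr : r = h - ratShift h) (a : ℂ)
    (hreg : ∀ b, b ≠ a → RegularAt b r) : RegularAt a r := by
  -- Away from `a`, poles of `h` propagate along unit steps. There are finitely many, so none lies
  -- on `a, a+1, …` and none on `a-1, a-2, …`.
  have hstep : ∀ b, b ≠ a → (RegularAt b h ↔ RegularAt (b - 1) h) := fun b hb => by
    rw [← regularAt_ratShift]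
    constructor <;> intro H
    · simpa [hr] using H.sub (hreg b hb)
    · simpa [hr] using H.add (hreg b hb)
  have hup : RegularAt a h := by
    obtain ⟨n, hn⟩ := exists_regularAt_add_nat h a
    induction n with
    | zero => simpa using hn
    | succ n ih =>
      refine ih ?_
      have := (hstep (a + (n + 1 : ℕ)) (by
        simpa using Nat.cast_add_one_ne_zero (R := ℂ) n)).1 hn
      rwa [Nat.cast_add_one, ← add_assoc, add_sub_cancel_right] at this
  have hdown : RegularAt (a - 1) h := by
    obtain ⟨n, hn⟩ := exists_regularAt_sub_nat h (a - 1)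
    induction n with
    | zero => simpa using hn
    | succ n ih =>
      refine ih ((hstep (a - 1 - n) ?_).2 ?_)
      · intro h0
        exact Nat.cast_add_one_ne_zero (R := ℂ) n (by linear_combination -h0)
      · rwa [sub_sub _ (n : ℂ) 1, ← Nat.cast_add_one]
  rw [hr]
  exact hup.sub (regularAt_ratShift.2 hdown)

theorem expandAt_nat_add_one_eq {f : RatFunc ℂ} (hf : ratShift f = f) (n : ℕ) :
    expandAt (n + 1) f = expandAt 1 f := by
  induction n with
  | zero => simp
  | succ n ih => rw [← ih, ← hf, expandAt_ratShift, hf]; simp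

/-- An invariant function has one and the same expansion at `s = 1, 2, 3, …`. One of these points is
not a pole, so none is, and the function takes a single value infinitely often. -/
theorem eq_algebraMap_of_ratShift_eq {f : RatFunc ℂ} (hf : ratShift f = f) :
    ∃ a : ℂ, f = algebraMap ℂ _ a := by
  obtain ⟨N, hN⟩ := exists_regularAt_add_nat f 1
  rw [RegularAt, add_comm, expandAt_nat_add_one_eq hf] at hN
  obtain ⟨w, hw⟩ := hN
  have key : ∀ n : ℕ, f.num.eval ((n : ℂ) + 1)⁻¹ =
      PowerSeries.constantCoeff w * f.denom.eval ((n : ℂ) + 1)⁻¹ := fun n => by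
    have hb := Nat.cast_add_one_ne_zero (R := ℂ) n
    have h1 := expandAt_nat_add_one_eq hf n
    rw [← hw] at h1
    have h2 : algebraMap _ (RatFunc ℂ) f.num = f * algebraMap _ _ f.denom := by
      rw [← div_eq_iff (RatFunc.algebraMap_ne_zero f.denom_ne_zero), RatFunc.num_div_denom]
    have h3 := congrArg (expandAt ((n : ℂ) + 1)) h2
    rw [map_mul, h1, expandAt_algebraMap hb, expandAt_algebraMap hb, ← map_mul] at h3
    have h4 := congrArg PowerSeries.constantCoeff (HahnSeries.ofPowerSeries_injective h3)
    rwa [map_mul, constantCoeff_aeval_inv, constantCoeff_aeval_inv] at h4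
  refine ⟨PowerSeries.constantCoeff w, ?_⟩
  have hz : f.num - Polynomial.C (PowerSeries.constantCoeff w) * f.denom = 0 := by
    refine Polynomial.eq_zero_of_infinite_isRoot _ ?_
    refine Set.infinite_of_injective_forall_mem (f := fun n : ℕ => ((n : ℂ) + 1)⁻¹)
      (fun m n hmn => by simpa using hmn) fun n => ?_
    simp [key n]
  rw [← RatFunc.num_div_denom f, div_eq_iff (RatFunc.algebraMap_ne_zero f.denom_ne_zero),
    sub_eq_zero.1 hz, map_mul, RatFunc.algebraMap_C, RatFunc.algebraMap_eq_C]

theorem not_exists_telescoper {ι : Type*} [Fintype ι] (a : ℂ) (κ c : ι → ℂ) (e : ι → ℕ)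
    (he : Function.Injective e) (he0 : ∀ i, e i ≠ 0) (hκ : ∀ i, κ i ≠ 0) (hc : c ≠ 0)
    (h : RatFunc ℂ) : ∑ i, algebraMap ℂ _ (c i) *
      (algebraMap ℂ _ (κ i) * ((RatFunc.X⁻¹ - algebraMap ℂ (RatFunc ℂ) a)⁻¹) ^ e i) ≠
        h - ratShift h := by
  intro heq
  have hexp : ∀ b, expandAt b (∑ i, algebraMap ℂ _ (c i) *
      (algebraMap ℂ _ (κ i) * ((RatFunc.X⁻¹ - algebraMap ℂ (RatFunc ℂ) a)⁻¹) ^ e i)) =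
      ∑ i, ((PowerSeries.C (c i * κ i) : PowerSeries ℂ) : ℂ⸨X⸩) *
        (((PowerSeries.C (b - a) + PowerSeries.X : PowerSeries ℂ) : ℂ⸨X⸩)⁻¹) ^ e i := fun b => by
    rw [map_sum]
    refine Finset.sum_congr rfl fun i _ => ?_
    rw [map_mul, map_mul, map_pow, expandAt_inv_X_sub, AlgHom.commutes, AlgHom.commutes, ← mul_assoc,
      ← map_mul]
    rfl
  have hreg := regularAt_of_eq_sub_ratShift heq a fun b hb => by
    rw [RegularAt, hexp]
    refine sum_mem fun i _ => mul_mem ⟨_, rfl⟩ (pow_mem ?_ _)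
    rw [← LaurentSeries.coe_inv_of_constantCoeff_ne_zero (by simpa using sub_ne_zero.2 hb)]
    exact ⟨_, rfl⟩
  obtain ⟨j, hj⟩ := Function.ne_iff.1 hc
  rw [RegularAt, hexp] at hreg
  obtain ⟨w, hw⟩ := hreg
  -- The pole orders `e i` are distinct, so the coefficient of order `-e j` at `a` is exactly `c j *
  -- κ j`; for a power series it must vanish.
  have hcoeff := congrArg (fun f : ℂ⸨X⸩ => f.coeff (-(e j : ℤ))) hw
  have hlt : -(e j : ℤ) < 0 := by have := he0 j; omega
  simp only [sub_self, map_zero, zero_add, HahnSeries.ofPowerSeries_X, HahnSeries.inv_single, inv_one,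
    HahnSeries.single_pow, HahnSeries.coeff_sum, HahnSeries.ofPowerSeries_C, HahnSeries.C_mul_eq_smul,
    HahnSeries.coeff_smul, one_pow] at hcoeff
  rw [PowerSeries.coeff_coe, if_pos hlt, Finset.sum_eq_single j] at hcoeff
  · simp [hκ j] at hcoeff
    exact hj hcoeff
  · intro i _ hij
    rw [HahnSeries.coeff_single_of_ne, smul_zero]
    intro h0
    refine hij (he ?_)
    simpa using h0.symm
  · simp

end RationalShift

/-! ### The shift and `d/ds` on power series, and the functional equation of `t B(x,t)`. -/

section PowerSeriesShift

open PowerSeries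

theorem mk_pow_mul_one_sub (x : ℂ) : (mk fun n => x ^ n : PowerSeries ℂ) * (1 - C x * X) = 1 := by
  ext n
  rw [mul_sub, mul_one, mul_left_comm, map_sub, coeff_C_mul]
  cases n with
  | zero => simp
  | succ n => simp [coeff_succ_mul_X, coeff_one, pow_succ']

/-- The power series `t / (1 - x t)`. -/
noncomputable def moebiusSeries (x : ℂ) : PowerSeries ℂ := X * mk fun n => x ^ n

theorem moebiusSeries_mul_one_sub (x : ℂ) : moebiusSeries x * (1 - C x * X) = X := by
  rw [moebiusSeries, mul_assoc, mk_pow_mul_one_sub, mul_one]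

theorem constantCoeff_moebiusSeries (x : ℂ) : constantCoeff (moebiusSeries x) = 0 := by
  simp [moebiusSeries]

/-- This is `d/ds (s-x)⁻¹ = -(s-x)⁻²`. For `x = 1` it is also the chain-rule factor that makes
`d/ds` commute with the shift. -/
theorem X_sq_mul_derivative_moebiusSeries (x : ℂ) :
    X ^ 2 * d⁄dX ℂ (moebiusSeries x) = moebiusSeries x ^ 2 := by
  set q : PowerSeries ℂ := mk fun n => x ^ n with hq
  have h1 : q * (1 - C x * X) = 1 := mk_pow_mul_one_sub x
  have h2 := congrArg (d⁄dX ℂ) h1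
  have hC : d⁄dX ℂ (C x : PowerSeries ℂ) = 0 := derivative_C
  simp only [Derivation.leibniz, map_sub, smul_eq_mul, derivative_X, hC, Derivation.map_one_eq_zero]
    at h2
  have h3 : d⁄dX ℂ q = C x * q ^ 2 := by
    linear_combination q * h2 - (d⁄dX ℂ q) * h1
  rw [moebiusSeries, ← hq, Derivation.leibniz, smul_eq_mul, smul_eq_mul, derivative_X, h3]
  linear_combination -X ^ 2 * q * h1

theorem hasSubst_moebiusSeries (x : ℂ) : HasSubst (moebiusSeries x) :=
  HasSubst.of_constantCoeff_zero' (constantCoeff_moebiusSeries x)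

/-- The endomorphism `t ↦ t / (1 - t)` of `ℂ[[t]]`. -/
noncomputable def seriesShift : PowerSeries ℂ →ₐ[ℂ] PowerSeries ℂ :=
  substAlgHom (hasSubst_moebiusSeries 1)

theorem seriesShift_apply (f : PowerSeries ℂ) : seriesShift f = f.subst (moebiusSeries 1) := by
  rw [seriesShift, coe_substAlgHom]

theorem seriesShift_X : seriesShift X = moebiusSeries 1 := substAlgHom_X _

/-- Zero constant term and unit linear coefficient give a compositional inverse. Injectivity is what
lets the shift extend to `ℂ((t))`. -/
theorem seriesShift_injective : Function.Injective seriesShift := by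
  have hu : IsUnit (coeff 1 (moebiusSeries 1)) := by
    rw [moebiusSeries, coeff_succ_X_mul 0]; simp
  have h0 := constantCoeff_moebiusSeries 1
  refine Function.LeftInverse.injective
    (g := fun f => f.subst (substInvOfIsUnit (moebiusSeries 1) hu)) fun f => ?_
  beta_reduce
  rw [seriesShift_apply, subst_comp_subst_apply (hasSubst_moebiusSeries 1)
    (HasSubst.substInvOfIsUnit _ hu), subst_substInvOfIsUnit_right _ h0 hu, X_subst]

/-- The derivation `-t² d/dt` of `ℂ[[t]]`, which is `d/ds` in the coordinate `s = 1 / t`. -/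
noncomputable def reciprocalDeriv (f : PowerSeries ℂ) : PowerSeries ℂ := -X ^ 2 * d⁄dX ℂ f

theorem reciprocalDeriv_add (f g : PowerSeries ℂ) :
    reciprocalDeriv (f + g) = reciprocalDeriv f + reciprocalDeriv g := by
  simp [reciprocalDeriv, mul_add]

theorem seriesShift_reciprocalDeriv (f : PowerSeries ℂ) :
    seriesShift (reciprocalDeriv f) = reciprocalDeriv (seriesShift f) := by
  rw [reciprocalDeriv, reciprocalDeriv, map_mul, map_neg, map_pow, seriesShift_X,
    seriesShift_apply f, derivative_subst (hasSubst_moebiusSeries 1), ← seriesShift_apply]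
  linear_combination (seriesShift (d⁄dX ℂ f)) * X_sq_mul_derivative_moebiusSeries 1

theorem iterate_reciprocalDeriv_moebiusSeries_sq (x : ℂ) (i : ℕ) :
    reciprocalDeriv^[i] (moebiusSeries x ^ 2) =
      C ((-1) ^ i * ((i + 1).factorial : ℂ)) * moebiusSeries x ^ (i + 2) := by
  induction i with
  | zero => simp
  | succ i ih =>
    rw [Function.iterate_succ_apply', ih, reciprocalDeriv, Derivation.leibniz, derivative_C,
      smul_zero, add_zero, smul_eq_mul, derivative_pow, Nat.factorial_succ (i + 1)]
    have h := X_sq_mul_derivative_moebiusSeries x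
    have hn : ((i + 2 : ℕ) : PowerSeries ℂ) = C ((i : ℂ) + 2) := by
      rw [← map_natCast (C (R := ℂ)), Nat.cast_add, Nat.cast_two]
    have e : C ((-1) ^ (i + 1) * (((i + 1 + 1) * (i + 1).factorial : ℕ) : ℂ)) =
      - (C ((-1) ^ i * ((i + 1).factorial : ℂ)) * C ((i : ℂ) + 2) : PowerSeries ℂ) := by
      rw [← map_mul, ← map_neg]
      congr 1
      push_cast
      ring
    rw [hn, e, show i + 2 - 1 = i + 1 by omega]
    linear_combination (-C ((-1) ^ i * ((i + 1).factorial : ℂ)) * C ((i : ℂ) + 2) *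
      moebiusSeries x ^ (i + 1)) * h

theorem seriesShift_iterate_reciprocalDeriv {f g : PowerSeries ℂ} (h : seriesShift f = f + g)
    (i : ℕ) : seriesShift (reciprocalDeriv^[i] f) =
      reciprocalDeriv^[i] f + reciprocalDeriv^[i] g := by
  induction i with
  | zero => exact h
  | succ i ih =>
    simp only [Function.iterate_succ_apply', seriesShift_reciprocalDeriv, ih, reciprocalDeriv_add]

/-- Both sides express `Bₙ(x+1)`. At `n = 0` the truncated exponent is harmless, its factor being 0.
-/
theorem sum_choose_mul_aeval_bernoulli (x : ℂ) (n : ℕ) :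
    ∑ k ∈ Finset.range (n + 1), (n.choose k : ℂ) * Polynomial.aeval x (Polynomial.bernoulli k) =
      Polynomial.aeval x (Polynomial.bernoulli n) + n * x ^ (n - 1) := by
  cases n with
  | zero => simp
  | succ n =>
    have h := congrArg (Polynomial.aeval x) (Polynomial.sum_bernoulli n)
    rw [map_sum, Polynomial.aeval_monomial] at h
    rw [Finset.sum_range_succ, add_comm]
    congr 1
    · simp
    · simpa [Algebra.smul_def] using h

theorem coeff_succ_moebiusSeries_one_pow (m k : ℕ) :
    coeff (m + 1) (moebiusSeries 1 ^ (k + 1)) = (m.choose k : ℂ) := by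
  have h : (mk fun n => (1 : ℂ) ^ n) = (mk 1 : PowerSeries ℂ) := by ext; simp
  rw [moebiusSeries, h, mul_pow, mk_one_pow_eq_mk_choose_add, coeff_X_pow_mul', coeff_mk]
  split_ifs with hk
  · congr 2; omega
  · rw [Nat.choose_eq_zero_of_lt (by omega), Nat.cast_zero]

theorem coeff_succ_moebiusSeries_sq (x : ℂ) (m : ℕ) :
    coeff (m + 1) (moebiusSeries x ^ 2) = (m : ℂ) * x ^ (m - 1) := by
  rw [moebiusSeries, mul_pow, pow_two X, mul_assoc, coeff_succ_X_mul]
  cases m with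
  | zero => simp
  | succ m =>
    rw [coeff_succ_X_mul, pow_two, coeff_mul, Finset.sum_congr rfl (g := fun _ => x ^ m)]
    · simp
    · rintro ⟨i, j⟩ hij
      rw [Finset.HasAntidiagonal.mem_antidiagonal] at hij
      simp [← hij, pow_add]

/-- The extra factor `t` turns `tᵏ` into `(t/(1-t))^(k+1)`, whose coefficient at `t^(m+1)` is
`m.choose k`; the claim becomes the Bernoulli recurrence. -/
theorem seriesShift_X_mul_bernoulliOGF (x : ℂ) :
    seriesShift (X * bernoulliOGF x) = X * bernoulliOGF x + moebiusSeries x ^ 2 := by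
  ext n
  rw [seriesShift_apply, coeff_subst' (hasSubst_moebiusSeries 1)]
  rw [finsum_eq_sum_of_support_subset (s := Finset.range (n + 1))]
  · cases n with
    | zero => simp [moebiusSeries]
    | succ m =>
      rw [Finset.sum_range_succ', map_add, coeff_succ_moebiusSeries_sq, coeff_succ_X_mul]
      simp only [coeff_succ_X_mul, coeff_succ_moebiusSeries_one_pow, coeff_zero_X_mul,
        bernoulliOGF, coeff_mk, smul_eq_mul]
      rw [← sum_choose_mul_aeval_bernoulli]
      rw [zero_mul, add_zero]
      exact Finset.sum_congr rfl fun k _ => mul_comm _ _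
  · intro d hd
    by_contra hlt
    rw [Finset.coe_range, Set.mem_Iio, not_lt] at hlt
    refine hd ?_
    have : coeff n (moebiusSeries 1 ^ d) = 0 := by
      rw [moebiusSeries, mul_pow, coeff_X_pow_mul', if_neg (by omega)]
    simp only [this, smul_zero]

/-- The endomorphism `t ↦ t / (1 - t)` of `ℂ((t))`. -/
noncomputable def laurentShift : ℂ⸨X⸩ →+* ℂ⸨X⸩ :=
  IsFractionRing.lift (A := PowerSeries ℂ) (K := ℂ⸨X⸩)
    (g := (HahnSeries.ofPowerSeries ℤ ℂ).comp (seriesShift : PowerSeries ℂ →+* PowerSeries ℂ))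
    (HahnSeries.ofPowerSeries_injective.comp seriesShift_injective)

theorem laurentShift_coe (f : PowerSeries ℂ) :
    laurentShift (f : ℂ⸨X⸩) = (seriesShift f : ℂ⸨X⸩) :=
  IsFractionRing.lift_algebraMap _ f

theorem RatFunc.algebraMap_laurentSeries_X :
    algebraMap (RatFunc ℂ) ℂ⸨X⸩ RatFunc.X = ((PowerSeries.X : PowerSeries ℂ) : ℂ⸨X⸩) := by
  rw [HahnSeries.ofPowerSeries_X]
  exact RatFunc.coe_X

theorem RatFunc.algebraMap_laurentSeries_coe (p : Polynomial ℂ) :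
    algebraMap (RatFunc ℂ) ℂ⸨X⸩ (algebraMap _ _ p) = ((p : PowerSeries ℂ) : ℂ⸨X⸩) :=
  (RatFunc.coe_coe p).symm

theorem RatFunc.algebraMap_laurentSeries_C (x : ℂ) :
    algebraMap (RatFunc ℂ) ℂ⸨X⸩ (algebraMap ℂ _ x) =
      ((PowerSeries.C x : PowerSeries ℂ) : ℂ⸨X⸩) := by
  rw [RatFunc.algebraMap_eq_C, ← RatFunc.algebraMap_C, RatFunc.algebraMap_laurentSeries_coe,
    Polynomial.coe_C]

theorem algebraMap_inv_X_sub (x : ℂ) :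
    algebraMap (RatFunc ℂ) ℂ⸨X⸩ (RatFunc.X⁻¹ - algebraMap ℂ _ x)⁻¹ = (moebiusSeries x : ℂ⸨X⸩) := by
  have h := congrArg (HahnSeries.ofPowerSeries ℤ ℂ) (moebiusSeries_mul_one_sub x)
  rw [map_mul, map_sub, map_one, map_mul] at h
  rw [map_inv₀, map_sub, map_inv₀, RatFunc.algebraMap_laurentSeries_X,
    RatFunc.algebraMap_laurentSeries_C]
  have hX : HahnSeries.ofPowerSeries ℤ ℂ X ≠ 0 := fun h0 =>
    X_ne_zero (HahnSeries.ofPowerSeries_injective (h0.trans (map_zero _).symm))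
  generalize HahnSeries.ofPowerSeries ℤ ℂ X = t at *
  generalize HahnSeries.ofPowerSeries ℤ ℂ (moebiusSeries x) = w at *
  have hw : w ≠ 0 := fun h0 => hX (by rw [← h, h0, zero_mul])
  rw [inv_eq_iff_eq_inv]
  field_simp
  linear_combination h

theorem laurentShift_algebraMap (f : RatFunc ℂ) :
    laurentShift (algebraMap (RatFunc ℂ) ℂ⸨X⸩ f) = algebraMap (RatFunc ℂ) ℂ⸨X⸩ (ratShift f) := by
  suffices h : laurentShift.comp (algebraMap (RatFunc ℂ) ℂ⸨X⸩) =
      (algebraMap (RatFunc ℂ) ℂ⸨X⸩).comp (ratShift : RatFunc ℂ →+* RatFunc ℂ) from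
    RingHom.congr_fun h f
  refine RatFunc.ringHom_ext_of_X (fun a => ?_) ?_
  · simp only [RingHom.comp_apply, RingHom.coe_coe, ← RatFunc.algebraMap_eq_C, AlgHom.commutes,
      RatFunc.algebraMap_laurentSeries_C, laurentShift_coe]
    congr 1
    exact seriesShift.commutes a
  · have := algebraMap_inv_X_sub 1
    rw [map_one] at this
    simp only [RingHom.comp_apply, RingHom.coe_coe, ratShift_X, this,
      RatFunc.algebraMap_laurentSeries_X, laurentShift_coe, seriesShift_X]

theorem aeval_iterate_reciprocalDeriv_ne_zero (x : ℂ) (n : ℕ)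
    (P : MvPolynomial (Fin n) (RatFunc ℂ)) (hP : P ≠ 0) :
    MvPolynomial.aeval (fun i : Fin n =>
      ((reciprocalDeriv^[i] (X * bernoulliOGF x) : PowerSeries ℂ) : ℂ⸨X⸩)) P ≠ 0 := by
  intro h0
  obtain ⟨c, h, hc, hσ, hsum⟩ := MvPolynomial.exists_telescoper_of_aeval_eq_zero
    (ratShift : RatFunc ℂ →+* RatFunc ℂ)
    (fun i : Fin n => algebraMap ℂ (RatFunc ℂ) ((-1) ^ (i : ℕ) * (((i : ℕ) + 1).factorial : ℂ)) *
      ((RatFunc.X⁻¹ - algebraMap ℂ (RatFunc ℂ) x)⁻¹) ^ ((i : ℕ) + 2)) laurentShift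
    laurentShift_algebraMap (fun i => by
      rw [laurentShift_coe, seriesShift_iterate_reciprocalDeriv (seriesShift_X_mul_bernoulliOGF x),
        iterate_reciprocalDeriv_moebiusSeries_sq, map_mul (algebraMap _ _), map_pow (algebraMap _ _),
        algebraMap_inv_X_sub, RatFunc.algebraMap_laurentSeries_C, map_add, map_mul, map_pow]) ⟨P, hP, h0⟩
  -- The coefficients are shift-invariant, hence complex constants, as the pole argument requires.
  choose c' hc' using fun i => eq_algebraMap_of_ratShift_eq (hσ i)
  refine not_exists_telescoper x
    (fun i : Fin n => (-1) ^ (i : ℕ) * (((i : ℕ) + 1).factorial : ℂ)) c'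
    (fun i : Fin n => (i : ℕ) + 2) (fun i j hij => ?_)
    (fun i => by simp) (fun i => ?_) (fun h0 => hc ?_) h ?_
  · exact Fin.ext (by simpa using hij)
  · exact mul_ne_zero (pow_ne_zero _ (by norm_num)) (Nat.cast_ne_zero.2 (Nat.factorial_ne_zero _))
  · ext i; rw [hc', h0]; simp
  · simpa only [hc', RingHom.coe_coe] using hsum

end PowerSeriesShift

/-! ### Change of basis between `(d/ds)ⁱ(t f)` and `∂ₜʲ f`. -/

theorem LaurentSeries.derivative_coe (f : PowerSeries ℂ) :
    LaurentSeries.derivative ℂ (f : ℂ⸨X⸩) = ((PowerSeries.derivative ℂ f : PowerSeries ℂ) : ℂ⸨X⸩) := by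
  ext n
  rw [LaurentSeries.derivative_apply, LaurentSeries.hasseDeriv_coeff, PowerSeries.coeff_coe,
    PowerSeries.coeff_coe, Nat.cast_one, Ring.choose_one_right]
  rcases lt_trichotomy n (-1) with h | rfl | h
  · rw [if_pos (by omega), if_pos (by omega), smul_zero]
  · simp
  · obtain ⟨m, rfl⟩ := Int.eq_ofNat_of_zero_le (show 0 ≤ n by omega)
    rw [if_neg (by omega), if_neg (by omega), PowerSeries.coeff_derivative,
      show ((m : ℤ) + 1).natAbs = m + 1 by omega, show (m : ℤ).natAbs = m by omega]
    simp [mul_comm]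

theorem LaurentSeries.iterate_derivative_coe (f : PowerSeries ℂ) (i : ℕ) :
    (LaurentSeries.derivative ℂ)^[i] (f : ℂ⸨X⸩) =
      (((PowerSeries.derivative ℂ)^[i] f : PowerSeries ℂ) : ℂ⸨X⸩) := by
  induction i with
  | zero => rfl
  | succ i ih =>
    rw [Function.iterate_succ_apply', ih, LaurentSeries.derivative_coe, Function.iterate_succ_apply']

/-- The coefficients of the operator `f ↦ (-t² d/dt)ⁱ (t f)` with respect to the powers of
`d/dt`. -/
noncomputable def reciprocalDerivCoeff : ℕ → ℕ → Polynomial ℂ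
  | 0, 0 => Polynomial.X
  | 0, _ + 1 => 0
  | i + 1, 0 => -Polynomial.X ^ 2 * Polynomial.derivative (reciprocalDerivCoeff i 0)
  | i + 1, j + 1 => -Polynomial.X ^ 2 *
      (Polynomial.derivative (reciprocalDerivCoeff i (j + 1)) + reciprocalDerivCoeff i j)

theorem reciprocalDerivCoeff_eq_zero {i j : ℕ} (h : i < j) : reciprocalDerivCoeff i j = 0 := by
  induction i generalizing j with
  | zero => cases j with
    | zero => omega
    | succ j => rfl
  | succ i ih => cases j with
    | zero => omega
    | succ j => rw [reciprocalDerivCoeff, ih (by omega), ih (by omega)]; simp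

/-- The diagonal entry is `(-1)ⁱ t^(2i+1)`. -/
theorem reciprocalDerivCoeff_self_ne_zero (i : ℕ) : reciprocalDerivCoeff i i ≠ 0 := by
  induction i with
  | zero => exact Polynomial.X_ne_zero
  | succ i ih =>
    rw [reciprocalDerivCoeff, reciprocalDerivCoeff_eq_zero (Nat.lt_succ_self i)]
    simpa using ih

/-- The bound `n` is left free so that all rows of a square matrix share one range of summation. -/
theorem iterate_reciprocalDeriv_X_mul (f : PowerSeries ℂ) {i n : ℕ} (h : i < n) :
    reciprocalDeriv^[i] (PowerSeries.X * f) = ∑ j ∈ Finset.range n,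
      (reciprocalDerivCoeff i j : PowerSeries ℂ) * (PowerSeries.derivative ℂ)^[j] f := by
  induction i generalizing n with
  | zero =>
    obtain ⟨n, rfl⟩ : ∃ m, n = m + 1 := ⟨n - 1, by omega⟩
    rw [Finset.sum_range_succ', Finset.sum_eq_zero]
    · simp [reciprocalDerivCoeff]
    · intro j _
      simp [reciprocalDerivCoeff]
  | succ i ih =>
    obtain ⟨n, rfl⟩ : ∃ m, n = m + 1 := ⟨n - 1, by omega⟩
    have h1 := ih (n := n) (by omega)
    have h2 := ih (n := n + 1) (by omega)
    have hd : PowerSeries.derivative ℂ (reciprocalDeriv^[i] (PowerSeries.X * f)) =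
        ∑ j ∈ Finset.range (n + 1), ((Polynomial.derivative (reciprocalDerivCoeff i j) :
          Polynomial ℂ) : PowerSeries ℂ) * (PowerSeries.derivative ℂ)^[j] f +
        ∑ j ∈ Finset.range n, (reciprocalDerivCoeff i j : PowerSeries ℂ) *
          (PowerSeries.derivative ℂ)^[j + 1] f := by
      rw [h2, map_sum]
      simp only [Derivation.leibniz, PowerSeries.derivative_coe, smul_eq_mul,
        Finset.sum_add_distrib, ← Function.iterate_succ_apply' (f := PowerSeries.derivative ℂ)]
      -- The term `j = n` would involve the derivative of order `n + 1`; its coefficient vanishes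
      -- since `i < n`.
      rw [Finset.sum_range_succ, reciprocalDerivCoeff_eq_zero (show i < n by omega), add_comm]
      simp [mul_comm]
    rw [Function.iterate_succ_apply', reciprocalDeriv, hd, Finset.sum_range_succ',
      Finset.sum_range_succ', add_right_comm, ← Finset.sum_add_distrib, mul_add, Finset.mul_sum]
    congr 1
    · refine Finset.sum_congr rfl fun j _ => ?_
      simp only [reciprocalDerivCoeff, Polynomial.coe_mul, Polynomial.coe_neg, Polynomial.coe_pow,
        Polynomial.coe_X, Polynomial.coe_add]
      ring
    · simp only [reciprocalDerivCoeff, Polynomial.coe_mul, Polynomial.coe_neg, Polynomial.coe_pow,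
        Polynomial.coe_X]
      ring

theorem Matrix.sum_algebraMap_mul_sum_of_mul_eq_one {ι K R : Type*} [Fintype ι] [DecidableEq ι]
    [Field K] [CommRing R] [Algebra K R] {B D : Matrix ι ι K} (h : B * D = 1) (v : ι → R) (i : ι) :
    ∑ j, algebraMap K R (B i j) * ∑ k, algebraMap K R (D j k) * v k = v i := by
  simp only [Finset.mul_sum, ← mul_assoc, ← map_mul]
  rw [Finset.sum_comm]
  simp only [← Finset.sum_mul, ← map_sum, ← Matrix.mul_apply, h, Matrix.one_apply]
  simp

/-- Algebraic dependence is preserved by an invertible linear change of the elements. -/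
theorem MvPolynomial.exists_ne_zero_aeval_eq_zero_of_isUnit_det {ι K L : Type*} [Fintype ι]
    [DecidableEq ι] [Field K] [Field L] [Algebra K L] {A : Matrix ι ι K} (hA : A.det ≠ 0)
    {y b : ι → L} (hy : ∀ i, y i = ∑ j, algebraMap K L (A i j) * b j) {P : MvPolynomial ι K}
    (hP : P ≠ 0) (hb : aeval b P = 0) : ∃ Q : MvPolynomial ι K, Q ≠ 0 ∧ aeval y Q = 0 := by
  have hA' : IsUnit A.det := isUnit_iff_ne_zero.2 hA
  refine ⟨aeval (fun i => ∑ j, algebraMap K _ (A⁻¹ i j) * X j) P, fun h0 => hP ?_, ?_⟩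
  · have := congrArg (aeval (R := K) fun i => ∑ j, algebraMap K _ (A i j) * X (R := K) j) h0
    rw [map_zero, ← AlgHom.comp_apply, comp_aeval] at this
    simp only [map_sum, map_mul, AlgHom.commutes, aeval_X] at this
    simpa only [Matrix.sum_algebraMap_mul_sum_of_mul_eq_one (Matrix.nonsing_inv_mul A hA'),
      aeval_X_left_apply] using this
  · rw [← AlgHom.comp_apply, comp_aeval]
    simp only [map_sum, map_mul, AlgHom.commutes, aeval_X, hy]
    simpa only [Matrix.sum_algebraMap_mul_sum_of_mul_eq_one (Matrix.nonsing_inv_mul A hA')] using hb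

theorem mainTheorem9 (x : ℂ) : IsDiffTranscendental (bernoulliOGF x : ℂ⸨X⸩) := by
  intro n P hP h0
  simp only [LaurentSeries.iterate_derivative_coe] at h0
  -- Row `i` writes `(d/ds)ⁱ(t B)` through the `∂ₜʲ B`; triangularity makes `A` invertible, so a
  -- relation among the latter yields one among the former.
  set A : Matrix (Fin (n + 1)) (Fin (n + 1)) (RatFunc ℂ) := Matrix.of fun i j =>
    algebraMap _ _ (reciprocalDerivCoeff i j) with hA
  have hdet : A.det ≠ 0 := by
    rw [Matrix.det_of_isLowerTriangular A fun i j hij => ?_]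
    · exact Finset.prod_ne_zero_iff.2 fun i _ =>
        RatFunc.algebraMap_ne_zero (reciprocalDerivCoeff_self_ne_zero i)
    · rw [hA, Matrix.of_apply, reciprocalDerivCoeff_eq_zero (show (i : ℕ) < j from hij), map_zero]
  obtain ⟨Q, hQ, hQ0⟩ := MvPolynomial.exists_ne_zero_aeval_eq_zero_of_isUnit_det hdet
    (y := fun i => ((reciprocalDeriv^[i] (PowerSeries.X * bernoulliOGF x) : PowerSeries ℂ) : ℂ⸨X⸩))
    (fun i => by
      rw [iterate_reciprocalDeriv_X_mul _ i.2, map_sum, Finset.sum_range]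
      simp only [hA, Matrix.of_apply, RatFunc.algebraMap_laurentSeries_coe, map_mul]) hP h0
  exact aeval_iterate_reciprocalDeriv_ne_zero x (n + 1) Q hQ hQ0
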